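/- Let $K$ be a field and let $\Gamma=(\Gamma_0,\Gamma_1)$ be a quiver (with arbitrary sets of vertices and arrows). Paths are finite composable sequences of arrows, written in the order in which they are traversed; vertices are the paths of length $0$; $s(p)$ and $t(p)$ denote the source and the target of a path $p$. The quiver algebra $K[\Gamma]$ is the (not necessarily unital) $K$-algebra with basis all paths, the product of $p$ and $q$ being the concatenation $pq$ if $t(p)=s(q)$ and $0$ otherwise. The path coalgebra $K\Gamma$ has the same basis, comultiplication $\Delta(p)=\sum_{qr=p}q\otimes r$, and counit $\varepsilon(v)=1$ for vertices $v$, $\varepsilon(p)=0$ for paths $p$ of positive length. An ideal means a two-sided ideal (and a $K$-subspace); it is cofinite if it has finite codimension over $K$; an ideal of $K[\Gamma]$ is monomial if it has a basis consisting of paths. The finite dual $K[\Gamma]^0$ is the space of all $f\in K[\Gamma]^*$ whose kernel contains a cofinite ideal. It is a coalgebra: $\Delta(f)=\sum_i u_i\otimes v_i$ (with $u_i,v_i\in K[\Gamma]^0$) if and only if $f(xy)=\sum_i u_i(x)v_i(y)$ for all $x,y\in K[\Gamma]$, and $\varepsilon(f)=\sum_{v\in\Gamma_0}f(v)$, a sum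 with finitely many non-zero terms. Let $\theta:K\Gamma\to K[\Gamma]^*$ be the linear map with $\theta(p)(q)=\delta_{p,q}$ for all paths $p,q$; it takes values in $K[\Gamma]^0$ and is a morphism of coalgebras $K\Gamma\to K[\Gamma]^0$. For a coalgebra $C$ let ${}^{C}\mathcal M$ be the category of left $C$-comodules, and let $F^\theta:{}^{K\Gamma}\mathcal M\to{}^{K[\Gamma]^0}\mathcal M$ be corestriction along $\theta$, which replaces the coaction $\rho:M\to K\Gamma\otimes M$ by $(\theta\otimes \mathrm{id}_M)\rho$. A representation of $\Gamma$ consists of $K$-vector spaces $V_u$ $(u\in\Gamma_0)$ and linear maps $f_a:V_{s(a)}\to V_{t(a)}$ $(a\in\Gamma_1)$; for a path $p=a_1\cdots a_n$ put $f_p=f_{a_n}\cdots f_{a_1}$, and $f_v=\mathrm{id}_{V_v}$ for a vertex $v$. It is locally finite if for all $u\in\Gamma_0$ and $x\in V_u$ the subspace of $\bigoplus_{v\in\Gamma_0}V_v$ spanned by the elements $f_p(x)$, $p$ a path with $s(p)=u$, is finite dimensional. It is locally nilpotent if for all $u\in\Gamma_0$ and $x\in V_u$ only finitely many paths $p$ with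 $s(p)=u$ satisfy $f_p(x)\ne 0$. Theorem. The following assertions are equivalent: (i) $\Gamma$ has no oriented cycles (that is, no path of positive length $p$ with $s(p)=t(p)$), and between any two vertices of $\Gamma$ there are only finitely many arrows. (ii) $\theta(K\Gamma)=K[\Gamma]^0$. (iii) Every cofinite ideal of $K[\Gamma]$ contains a cofinite monomial ideal. (iv) The functor $F^\theta:{}^{K\Gamma}\mathcal M\to{}^{K[\Gamma]^0}\mathcal M$ is an equivalence of categories. (v) Every locally finite representation of $\Gamma$ is locally nilpotent. -/

import Mathlib

noncomputable section

namespace QuiverCoalg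

open scoped TensorProduct
open Submodule (CoFG)

/-! ### Separating families of functionals on tensor products -/

section Separation

variable {K : Type*} [Field K]

/-- The functional `φ ⊗ ψ` on `M ⊗ N`. -/
abbrev pairFun {M N : Type*} [AddCommMonoid M] [Module K M] [AddCommMonoid N] [Module K N]
    (φ : Module.Dual K M) (ψ : Module.Dual K N) : Module.Dual K (M ⊗[K] N) :=
  TensorProduct.dualDistrib K M N (φ ⊗ₜ ψ)

theorem eq_of_pairFun {M N X Y : Type*} [AddCommMonoid M] [Module K M] [AddCommMonoid N]
    [Module K N] (φ : X → Module.Dual K M) (ψ : Y → Module.Dual K N)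
    (hφ : ∀ m m', (∀ x, φ x m = φ x m') → m = m') (hψ : ∀ n n', (∀ y, ψ y n = ψ y n') → n = n')
    {s t : M ⊗[K] N} (h : ∀ x y, pairFun (φ x) (ψ y) s = pairFun (φ x) (ψ y) t) : s = t := by
  classical
  let _ : AddCommGroup M := Module.addCommMonoidToAddCommGroup K
  let b := Module.Basis.ofVectorSpace K M
  let E := TensorProduct.equivFinsuppOfBasisLeft (N := N) b
  have key : ∀ x y, ∀ t : M ⊗[K] N,
      pairFun (φ x) (ψ y) t = φ x (b.repr.symm ((E t).mapRange (ψ y) (map_zero _))) := by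
    intro x y t
    induction t with
    | zero => simp
    | add s t hs ht =>
      rw [map_add, hs, ht, map_add, Finsupp.mapRange_add (by simp), map_add, map_add]
    | tmul m n =>
      have : (E (m ⊗ₜ[K] n)).mapRange (ψ y) (map_zero _) = ψ y n • b.repr m := by
        ext i
        simp [E, mul_comm]
      rw [this]
      simp [mul_comm]
  apply E.injective
  ext i
  refine hψ _ _ fun y => ?_
  have := hφ _ _ fun x => (key x y s).symm.trans ((h x y).trans (key x y t))
  simpa using DFunLike.congr_fun (b.repr.symm.injective this) i

theorem pairFun_map {M N M' N' : Type*} [AddCommMonoid M] [Module K M] [AddCommMonoid N]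
    [Module K N] [AddCommMonoid M'] [Module K M'] [AddCommMonoid N'] [Module K N']
    (φ : Module.Dual K M') (ψ : Module.Dual K N') (f : M →ₗ[K] M') (g : N →ₗ[K] N')
    (t : M ⊗[K] N) :
    pairFun φ ψ (TensorProduct.map f g t) = pairFun (φ ∘ₗ f) (ψ ∘ₗ g) t := by
  induction t with
  | zero => simp
  | add s t hs ht => simp only [map_add, hs, ht]
  | tmul m n => simp

theorem pairFun_assoc {M N P : Type*} [AddCommMonoid M] [Module K M] [AddCommMonoid N]
    [Module K N] [AddCommMonoid P] [Module K P]
    (φ : Module.Dual K M) (ψ : Module.Dual K N) (χ : Module.Dual K P)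
    (t : (M ⊗[K] N) ⊗[K] P) :
    pairFun φ (pairFun ψ χ) (TensorProduct.assoc K M N P t) = pairFun (pairFun φ ψ) χ t := by
  induction t with
  | zero => simp
  | add s t hs ht => simp only [map_add, hs, ht]
  | tmul s p =>
    induction s with
    | zero => simp
    | add s t hs ht => simp only [TensorProduct.add_tmul, map_add, hs, ht]
    | tmul m n => simp [mul_assoc]

/-- A comultiplication that is dual to an associative product is coassociative. -/
theorem coassoc_of_pairing {C A : Type*} [AddCommMonoid C] [Module K C] [Semigroup A]
    (φ : A → Module.Dual K C) (hφ : ∀ c c', (∀ x, φ x c = φ x c') → c = c')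
    (Δ : C →ₗ[K] C ⊗[K] C) (hΔ : ∀ x y c, pairFun (φ x) (φ y) (Δ c) = φ (x * y) c) :
    TensorProduct.assoc K C C C ∘ₗ Δ.rTensor C ∘ₗ Δ = Δ.lTensor C ∘ₗ Δ := by
  have hΔ' : ∀ x y, pairFun (φ x) (φ y) ∘ₗ Δ = φ (x * y) := fun x y =>
    LinearMap.ext fun c => hΔ x y c
  ext c
  refine eq_of_pairFun φ (fun yz : A × A => pairFun (φ yz.1) (φ yz.2)) hφ
    (fun _ _ ht => eq_of_pairFun φ φ hφ hφ fun x y => ht (x, y)) ?_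
  rintro x ⟨y, z⟩
  simp only [LinearMap.comp_apply, LinearEquiv.coe_coe]
  rw [pairFun_assoc, LinearMap.rTensor, LinearMap.lTensor, pairFun_map, pairFun_map, hΔ', hΔ',
    LinearMap.comp_id, LinearMap.comp_id, hΔ, hΔ, mul_assoc]

/-- A functional that agrees, on every element, with `φ (e F)` for all large `F`, where the `e F`
are local units, is a counit. -/
theorem counit_of_pairing {C A ι : Type*} [AddCommMonoid C] [Module K C] [Semigroup A]
    (φ : A → Module.Dual K C) (hφ : ∀ c c', (∀ x, φ x c = φ x c') → c = c')
    (Δ : C →ₗ[K] C ⊗[K] C) (hΔ : ∀ x y c, pairFun (φ x) (φ y) (Δ c) = φ (x * y) c)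
    (e : Finset ι → A) (he : ∀ a, ∃ F₀, ∀ F, F₀ ⊆ F → e F * a = a ∧ a * e F = a)
    (ε : Module.Dual K C) (hε : ∀ c, ∃ F₀, ∀ F, F₀ ⊆ F → ε c = φ (e F) c) :
    ε.rTensor C ∘ₗ Δ = TensorProduct.mk K _ _ 1 ∧
      ε.lTensor C ∘ₗ Δ = (TensorProduct.mk K _ _).flip 1 := by
  classical
  have sepK : ∀ k k' : K, (∀ _ : Unit, (LinearMap.id : K →ₗ[K] K) k =
      (LinearMap.id : K →ₗ[K] K) k') → k = k' := fun k k' h => h ()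
  have h1 : ∀ (a : A) (t : C ⊗[K] C), ∃ F₀, ∀ F, F₀ ⊆ F →
      pairFun ε (φ a) t = pairFun (φ (e F)) (φ a) t ∧
      pairFun (φ a) ε t = pairFun (φ a) (φ (e F)) t := by
    intro a t
    induction t with
    | zero => exact ⟨∅, by simp⟩
    | add s t hs ht =>
      obtain ⟨F1, h1⟩ := hs
      obtain ⟨F2, h2⟩ := ht
      refine ⟨F1 ∪ F2, fun F hF => ?_⟩
      have a1 := h1 F (Finset.union_subset_left hF)
      have a2 := h2 F (Finset.union_subset_right hF)
      simp only [map_add, a1.1, a1.2, a2.1, a2.2, and_self]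
    | tmul m n =>
      obtain ⟨F1, h1⟩ := hε m
      obtain ⟨F2, h2⟩ := hε n
      refine ⟨F1 ∪ F2, fun F hF => ?_⟩
      have a1 := h1 F (Finset.union_subset_left hF)
      have a2 := h2 F (Finset.union_subset_right hF)
      simp [a1, a2]
  constructor
  · ext c
    refine eq_of_pairFun (fun _ : Unit => (LinearMap.id : K →ₗ[K] K)) φ sepK hφ fun _ a => ?_
    obtain ⟨F1, h1⟩ := h1 a (Δ c)
    obtain ⟨F2, h2⟩ := he a
    simp only [LinearMap.comp_apply, TensorProduct.mk_apply]
    rw [LinearMap.rTensor, pairFun_map, LinearMap.id_comp, LinearMap.comp_id,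
      (h1 (F1 ∪ F2) Finset.subset_union_left).1, hΔ, (h2 (F1 ∪ F2) Finset.subset_union_right).1]
    simp
  · ext c
    refine eq_of_pairFun φ (fun _ : Unit => (LinearMap.id : K →ₗ[K] K)) hφ sepK fun a _ => ?_
    obtain ⟨F1, h1⟩ := h1 a (Δ c)
    obtain ⟨F2, h2⟩ := he a
    simp only [LinearMap.comp_apply, TensorProduct.mk_apply, LinearMap.flip_apply]
    rw [LinearMap.lTensor, pairFun_map, LinearMap.id_comp, LinearMap.comp_id,
      (h1 (F1 ∪ F2) Finset.subset_union_left).2, hΔ, (h2 (F1 ∪ F2) Finset.subset_union_right).2]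
    simp

end Separation

/-! ### The finite dual of an algebra that need not have an identity -/

section FiniteDual

variable (K A : Type*) [Field K] [NonUnitalRing A] [Module K A]

variable {K A} in
/-- Two-sided ideals of a (not necessarily unital) `K`-algebra: subspaces that absorb
multiplication on both sides. -/
def IsIdeal (I : Submodule K A) : Prop :=
  ∀ a : A, ∀ x ∈ I, a * x ∈ I ∧ x * a ∈ I

/-- The finite dual `A⁰`: linear functionals whose kernel contains an ideal of finite
codimension (`CoFG` means that the quotient is finite dimensional). -/
def finiteDual : Submodule K (Module.Dual K A) where
  carrier := {f | ∃ I : Submodule K A, IsIdeal I ∧ I.CoFG ∧ I ≤ LinearMap.ker f}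
  zero_mem' := ⟨⊤, fun _ _ _ => ⟨trivial, trivial⟩, CoFG.top, by simp⟩
  add_mem' := by
    rintro f g ⟨I, hI, hI', hf⟩ ⟨J, hJ, hJ', hg⟩
    refine ⟨I ⊓ J, fun a x hx => ⟨⟨(hI a x hx.1).1, (hJ a x hx.2).1⟩,
      ⟨(hI a x hx.1).2, (hJ a x hx.2).2⟩⟩, hI'.inf hJ', fun x hx => ?_⟩
    have h1 : f x = 0 := hf hx.1
    have h2 : g x = 0 := hg hx.2
    simp [h1, h2]
  smul_mem' := by
    rintro c f ⟨I, hI, hI', hf⟩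
    refine ⟨I, hI, hI', fun x hx => ?_⟩
    have h1 : f x = 0 := hf hx
    simp [h1]

variable {K A}

/-- Evaluation at `a`, as a functional on the finite dual. -/
def finiteDualEval (a : A) : Module.Dual K (finiteDual K A) :=
  (Module.Dual.eval K A a) ∘ₗ (finiteDual K A).subtype

@[simp] theorem finiteDualEval_apply (a : A) (f : finiteDual K A) :
    finiteDualEval a f = (f : Module.Dual K A) a := rfl

theorem finiteDualEval_separating (f g : finiteDual K A)
    (h : ∀ a : A, finiteDualEval a f = finiteDualEval a g) : f = g :=
  Subtype.ext (LinearMap.ext h)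

/-- The natural map `A⁰ ⊗ A⁰ → (A ⊗ A)*`. -/
def finiteDualPsi : finiteDual K A ⊗[K] finiteDual K A →ₗ[K] Module.Dual K (A ⊗[K] A) :=
  TensorProduct.dualDistrib K A A ∘ₗ
    TensorProduct.map (finiteDual K A).subtype (finiteDual K A).subtype

theorem finiteDualPsi_tmul (t : finiteDual K A ⊗[K] finiteDual K A) (x y : A) :
    finiteDualPsi t (x ⊗ₜ y) = pairFun (finiteDualEval x) (finiteDualEval y) t := by
  induction t with
  | zero => simp
  | add s t hs ht => simp only [map_add, LinearMap.add_apply, hs, ht]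
  | tmul m n => simp [finiteDualPsi]

theorem finiteDualPsi_injective : Function.Injective (finiteDualPsi (K := K) (A := A)) := by
  intro s t h
  refine eq_of_pairFun finiteDualEval finiteDualEval finiteDualEval_separating
    finiteDualEval_separating fun x y => ?_
  rw [← finiteDualPsi_tmul, ← finiteDualPsi_tmul, h]

variable [IsScalarTower K A A] [SMulCommClass K A A]

/-- The dual `M* : A⁰ → (A ⊗ A)*` of the multiplication `M` of `A`. -/
def finiteDualMulDual : finiteDual K A →ₗ[K] Module.Dual K (A ⊗[K] A) :=
  (LinearMap.mul' K A).dualMap ∘ₗ (finiteDual K A).subtype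

theorem finiteDualMulDual_tmul (f : finiteDual K A) (x y : A) :
    finiteDualMulDual f (x ⊗ₜ y) = (f : Module.Dual K A) (x * y) := by
  simp [finiteDualMulDual]

theorem finiteDualMulDual_mem (f : finiteDual K A) :
    finiteDualMulDual f ∈ LinearMap.range (finiteDualPsi (K := K) (A := A)) := by
  obtain ⟨f, I, hI, hfin, hf⟩ := f
  let n := Module.finrank K (A ⧸ I)
  let b : Module.Basis (Fin n) K (A ⧸ I) := Module.finBasis K (A ⧸ I)
  choose r hr using fun i => Submodule.mkQ_surjective I (b i)
  let u : Fin n → finiteDual K A := fun i => ⟨b.coord i ∘ₗ I.mkQ, I, hI, hfin, fun x hx => by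
    have : (Submodule.Quotient.mk x : A ⧸ I) = 0 := (Submodule.Quotient.mk_eq_zero I).2 hx
    simp [this]⟩
  let v : Fin n → finiteDual K A := fun i => ⟨f ∘ₗ LinearMap.mulLeft K (r i), I, hI, hfin,
    fun x hx => hf (hI (r i) x hx).1⟩
  refine ⟨∑ i, u i ⊗ₜ v i, ?_⟩
  refine TensorProduct.ext' fun x y => ?_
  rw [finiteDualMulDual_tmul, finiteDualPsi_tmul, map_sum]
  have hx : x - ∑ i, b.coord i (I.mkQ x) • r i ∈ I := by
    rw [← Submodule.Quotient.mk_eq_zero, ← Submodule.mkQ_apply, map_sub, map_sum, sub_eq_zero]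
    simp only [map_smul, hr]
    exact (b.sum_repr _).symm
  have h0 : f ((x - ∑ i, b.coord i (I.mkQ x) • r i) * y) = 0 := hf (hI y _ hx).2
  rw [sub_mul, map_sub, sub_eq_zero, Finset.sum_mul, map_sum] at h0
  change _ = f (x * y)
  rw [h0]
  refine Finset.sum_congr rfl fun i _ => ?_
  rw [smul_mul_assoc, map_smul]
  simp [u, v]

/-- The comultiplication `ψ⁻¹ M*` of the finite dual: `Δ f = ∑ uᵢ ⊗ vᵢ` if and only if
`f (x y) = ∑ uᵢ(x) vᵢ(y)` for all `x`, `y`. -/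
def finiteDualComul : finiteDual K A →ₗ[K] finiteDual K A ⊗[K] finiteDual K A :=
  (LinearEquiv.ofInjective finiteDualPsi finiteDualPsi_injective).symm.toLinearMap ∘ₗ
    finiteDualMulDual.codRestrict (LinearMap.range finiteDualPsi) finiteDualMulDual_mem

theorem finiteDualPsi_comul (f : finiteDual K A) :
    finiteDualPsi (finiteDualComul f) = finiteDualMulDual f := by
  have := LinearEquiv.apply_symm_apply
    (LinearEquiv.ofInjective (finiteDualPsi (K := K) (A := A)) finiteDualPsi_injective)
    (finiteDualMulDual.codRestrict (LinearMap.range finiteDualPsi) finiteDualMulDual_mem f)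
  exact congrArg Subtype.val this

theorem pairFun_finiteDualComul (x y : A) (f : finiteDual K A) :
    pairFun (finiteDualEval x) (finiteDualEval y) (finiteDualComul f) =
      finiteDualEval (x * y) f := by
  rw [← finiteDualPsi_tmul, finiteDualPsi_comul, finiteDualMulDual_tmul, finiteDualEval_apply]

end FiniteDual

/-! ### Paths of a quiver, bundled with their endpoints -/

section Paths

/-- A path of the quiver `V`, from `src` to `tgt`; the vertex `v` is the path `nil` of length zero
at `v`. -/
@[ext] structure QPath (V : Type*) [Quiver V] where
  src : V
  tgt : V
  path : Quiver.Path src tgt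

variable {V : Type*} [Quiver V]

open Classical in
/-- The path `pq`, first `p` and then `q`, which is defined when `p` ends where `q` starts. -/
def QPath.concat (p q : QPath V) : Option (QPath V) :=
  if h : p.tgt = q.src then some ⟨p.src, q.tgt, p.path.comp (q.path.cast h.symm rfl)⟩ else none

theorem QPath.concat_mk {a b c : V} (p : Quiver.Path a b) (q : Quiver.Path b c) :
    QPath.concat ⟨a, b, p⟩ ⟨b, c, q⟩ = some ⟨a, c, p.comp q⟩ := by
  simp [QPath.concat]

theorem QPath.concat_eq_some {p q r : QPath V} (h : p.concat q = some r) :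
    ∃ (a b c : V) (p' : Quiver.Path a b) (q' : Quiver.Path b c),
      p = ⟨a, b, p'⟩ ∧ q = ⟨b, c, q'⟩ ∧ r = ⟨a, c, p'.comp q'⟩ := by
  obtain ⟨a, b, p⟩ := p
  obtain ⟨b', c, q⟩ := q
  by_cases hb : b = b'
  · subst hb
    rw [QPath.concat_mk] at h
    exact ⟨a, b, c, p, q, rfl, rfl, (Option.some.inj h).symm⟩
  · simp [QPath.concat, hb] at h

theorem QPath.concat_assoc (p q r : QPath V) :
    (p.concat q).bind (fun x => x.concat r) = (q.concat r).bind (fun x => p.concat x) := by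
  obtain ⟨a, b, p⟩ := p
  obtain ⟨b', c, q⟩ := q
  obtain ⟨c', d, r⟩ := r
  by_cases hb : b = b'
  · subst hb
    by_cases hc : c = c'
    · subst hc
      simp [QPath.concat_mk]
    · simp [QPath.concat, hc]
  · by_cases hc : c = c'
    · subst hc
      simp [QPath.concat, hb]
    · simp [QPath.concat, hb, hc]

theorem finite_splits_aux {a b : V} (p : Quiver.Path a b) :
    {x : Σ c : V, Quiver.Path a c × Quiver.Path c b | x.2.1.comp x.2.2 = p}.Finite := by
  induction p with
  | nil =>
    refine (Set.finite_singleton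
      (⟨a, .nil, .nil⟩ : Σ c : V, Quiver.Path a c × Quiver.Path c a)).subset ?_
    rintro ⟨c, q, r⟩ h
    cases r with
    | nil => cases h; rfl
    | cons r e => cases h
  | @cons b c p e ih =>
    refine ((ih.image fun x => (⟨x.1, x.2.1, x.2.2.cons e⟩ :
      Σ d : V, Quiver.Path a d × Quiver.Path d c)).union
      (Set.finite_singleton ⟨c, p.cons e, .nil⟩)).subset ?_
    rintro ⟨d, q, r⟩ h
    cases r with
    | nil => cases h; exact Or.inr rfl
    | cons r e =>
      cases h
      exact Or.inl ⟨⟨d, q, r⟩, rfl, rfl⟩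

theorem QPath.finite_splits (p : QPath V) :
    {qr : QPath V × QPath V | qr.1.concat qr.2 = some p}.Finite := by
  refine ((finite_splits_aux p.path).image fun x =>
    ((⟨p.src, x.1, x.2.1⟩, ⟨x.1, p.tgt, x.2.2⟩) : QPath V × QPath V)).subset ?_
  rintro ⟨q, r⟩ h
  obtain ⟨x, y, z, q', r', rfl, rfl, rfl⟩ := QPath.concat_eq_some h
  exact ⟨⟨y, q', r'⟩, rfl, rfl⟩

end Paths

/-! ### The quiver algebra `K[V]` -/

section QuiverAlgebra

variable (K V : Type*) [Field K] [Quiver V]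

/-- The underlying space of the quiver algebra: the vector space with basis all paths. -/
def QuiverAlgebra : Type _ := QPath V →₀ K

instance : AddCommGroup (QuiverAlgebra K V) := inferInstanceAs (AddCommGroup (QPath V →₀ K))

instance : Module K (QuiverAlgebra K V) := inferInstanceAs (Module K (QPath V →₀ K))

variable {V}

/-- A path, as an element of the quiver algebra. -/
def ofPath (p : QPath V) : QuiverAlgebra K V := Finsupp.single p (1 : K)

/-- The product of two paths in the quiver algebra: `pq` if `p` ends where `q` starts, else `0`. -/
def pathMul (p q : QPath V) : QuiverAlgebra K V := (p.concat q).elim 0 (ofPath K)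

variable (V)

/-- The bilinear multiplication of the quiver algebra that extends the product of paths. -/
def quiverMul : QuiverAlgebra K V →ₗ[K] QuiverAlgebra K V →ₗ[K] QuiverAlgebra K V :=
  Finsupp.linearCombination K fun p : QPath V =>
    (Finsupp.linearCombination K fun q : QPath V => pathMul K p q :
      (QPath V →₀ K) →ₗ[K] QuiverAlgebra K V)

variable {K V}

theorem quiverMul_ofPath (p q : QPath V) :
    quiverMul K V (ofPath K p) (ofPath K q) = pathMul K p q := by
  have h := Finsupp.linearCombination_single (R := K) (v := fun p : QPath V =>
    (Finsupp.linearCombination K fun q : QPath V => pathMul K p q :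
      (QPath V →₀ K) →ₗ[K] QuiverAlgebra K V)) 1 p
  have h2 := Finsupp.linearCombination_single (R := K) (v := fun q : QPath V => pathMul K p q) 1 q
  rw [one_smul] at h h2
  exact (LinearMap.congr_fun h _).trans h2

@[elab_as_elim]
theorem QuiverAlgebra.induction {P : QuiverAlgebra K V → Prop} (zero : P 0)
    (add : ∀ x y, P x → P y → P (x + y)) (smul : ∀ (c : K) p, P (c • ofPath K p))
    (x : QuiverAlgebra K V) : P x := by
  refine Finsupp.induction_linear (motive := P) x zero add fun p c => ?_
  have e : c • ofPath K p = (Finsupp.single p c : QPath V →₀ K) := Finsupp.smul_single_one p c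
  exact e ▸ smul c p

theorem QuiverAlgebra.linearMap_ext {M : Type*} [AddCommMonoid M] [Module K M]
    {f g : QuiverAlgebra K V →ₗ[K] M} (h : ∀ p, f (ofPath K p) = g (ofPath K p)) : f = g := by
  refine LinearMap.ext fun x => ?_
  induction x using QuiverAlgebra.induction with
  | zero => simp
  | add x y hx hy => simp only [map_add, hx, hy]
  | smul c p => simp only [map_smul, h]

instance : Mul (QuiverAlgebra K V) := ⟨fun x y => quiverMul K V x y⟩

theorem QuiverAlgebra.mul_def (x y : QuiverAlgebra K V) : x * y = quiverMul K V x y := rfl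

theorem ofPath_mul_ofPath (p q : QPath V) :
    ofPath K p * ofPath K q = (p.concat q).elim 0 (ofPath K) := quiverMul_ofPath p q

theorem quiverMul_assoc (x y z : QuiverAlgebra K V) :
    quiverMul K V (quiverMul K V x y) z = quiverMul K V x (quiverMul K V y z) := by
  have key : ∀ p q r : QPath V,
      quiverMul K V (quiverMul K V (ofPath K p) (ofPath K q)) (ofPath K r) =
        quiverMul K V (ofPath K p) (quiverMul K V (ofPath K q) (ofPath K r)) := by
    intro p q r
    have h := congrArg (fun o : Option (QPath V) => o.elim 0 (ofPath K)) (QPath.concat_assoc p q r)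
    have h1 : ∀ o : Option (QPath V), quiverMul K V (o.elim 0 (ofPath K)) (ofPath K r) =
        (o.bind fun x => x.concat r).elim 0 (ofPath K) := by
      rintro (_ | x)
      · simp
      · exact quiverMul_ofPath x r
    have h2 : ∀ o : Option (QPath V), quiverMul K V (ofPath K p) (o.elim 0 (ofPath K)) =
        (o.bind fun x => p.concat x).elim 0 (ofPath K) := by
      rintro (_ | x)
      · simp
      · exact quiverMul_ofPath p x
    rw [quiverMul_ofPath, quiverMul_ofPath, pathMul, pathMul, h1, h2]
    exact h
  induction x using QuiverAlgebra.induction with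
  | zero => simp
  | add x x' hx hx' => simp only [map_add, LinearMap.add_apply, hx, hx']
  | smul c p =>
    induction y using QuiverAlgebra.induction with
    | zero => simp
    | add y y' hy hy' => simp only [map_add, LinearMap.add_apply, hy, hy']
    | smul d q =>
      induction z using QuiverAlgebra.induction with
      | zero => simp
      | add z z' hz hz' => simp only [map_add, hz, hz']
      | smul e r => simp only [map_smul, LinearMap.smul_apply, key]

instance : NonUnitalRing (QuiverAlgebra K V) where
  left_distrib x y z := map_add (quiverMul K V x) y z
  right_distrib x y z := by simp only [QuiverAlgebra.mul_def, map_add, LinearMap.add_apply]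
  zero_mul x := by simp only [QuiverAlgebra.mul_def, map_zero, LinearMap.zero_apply]
  mul_zero x := by simp only [QuiverAlgebra.mul_def, map_zero]
  mul_assoc x y z := quiverMul_assoc x y z

instance : IsScalarTower K (QuiverAlgebra K V) (QuiverAlgebra K V) :=
  ⟨fun c x y => by simp only [smul_eq_mul, QuiverAlgebra.mul_def, map_smul, LinearMap.smul_apply]⟩

instance : SMulCommClass K (QuiverAlgebra K V) (QuiverAlgebra K V) :=
  ⟨fun c x y => by simp only [smul_eq_mul, QuiverAlgebra.mul_def, map_smul]⟩

/-- Monomial ideals of the quiver algebra: ideals that have a basis consisting of paths. -/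
def IsMonomialIdeal (I : Submodule K (QuiverAlgebra K V)) : Prop :=
  IsIdeal I ∧ ∃ S : Set (QPath V), I = Submodule.span K (ofPath K '' S)

variable (K) in
/-- The idempotent of the quiver algebra given by a vertex. -/
def vertex (v : V) : QuiverAlgebra K V := ofPath K ⟨v, v, .nil⟩

theorem vertex_mul_ofPath (v : V) (p : QPath V) [Decidable (v = p.src)] :
    vertex K v * ofPath K p = if v = p.src then ofPath K p else 0 := by
  obtain ⟨a, b, p⟩ := p
  rw [vertex, ofPath_mul_ofPath]
  split_ifs with h
  · dsimp at h
    subst h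
    simp [QPath.concat_mk]
  · dsimp at h
    simp [QPath.concat, h]

theorem ofPath_mul_vertex (v : V) (p : QPath V) [Decidable (v = p.tgt)] :
    ofPath K p * vertex K v = if v = p.tgt then ofPath K p else 0 := by
  obtain ⟨a, b, p⟩ := p
  rw [vertex, ofPath_mul_ofPath]
  split_ifs with h
  · dsimp at h
    subst h
    simp [QPath.concat_mk]
  · dsimp at h
    simp [QPath.concat, Ne.symm h]

theorem vertex_mul_vertex (v w : V) [Decidable (v = w)] :
    vertex K v * vertex K w = if v = w then vertex K w else 0 :=
  vertex_mul_ofPath v ⟨w, w, .nil⟩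

theorem vertexSum_local_unit (a : QuiverAlgebra K V) : ∃ F₀ : Finset V, ∀ F, F₀ ⊆ F →
    (∑ v ∈ F, vertex K v) * a = a ∧ a * (∑ v ∈ F, vertex K v) = a := by
  classical
  induction a using QuiverAlgebra.induction with
  | zero => exact ⟨∅, by simp⟩
  | add x y hx hy =>
    obtain ⟨F1, h1⟩ := hx
    obtain ⟨F2, h2⟩ := hy
    refine ⟨F1 ∪ F2, fun F hF => ?_⟩
    have a1 := h1 F (Finset.union_subset_left hF)
    have a2 := h2 F (Finset.union_subset_right hF)
    rw [mul_add, add_mul, a1.1, a1.2, a2.1, a2.2]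
    exact ⟨rfl, rfl⟩
  | smul c p =>
    refine ⟨{p.src, p.tgt}, fun F hF => ?_⟩
    have h1 : p.src ∈ F := hF (by simp)
    have h2 : p.tgt ∈ F := hF (by simp)
    rw [mul_smul_comm, smul_mul_assoc, Finset.sum_mul, Finset.mul_sum]
    simp only [vertex_mul_ofPath, ofPath_mul_vertex, Finset.sum_ite_eq', h1, h2, if_true, and_self]

/-- Only finitely many vertices lie outside an ideal of finite codimension. -/
theorem finite_vertex_notMem {I : Submodule K (QuiverAlgebra K V)} (hI : IsIdeal I)
    (hfin : I.CoFG) : {v : V | vertex K v ∉ I}.Finite := by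
  classical
  have hli : LinearIndependent K fun v : {v : V | vertex K v ∉ I} => I.mkQ (vertex K v.1) := by
    rw [linearIndependent_iff']
    intro s g hs v hv
    rw [← Finset.sum_congr rfl (fun i _ => map_smul I.mkQ (g i) (vertex K i.1)), ← map_sum,
      Submodule.mkQ_apply, Submodule.Quotient.mk_eq_zero] at hs
    have h := (hI (vertex K v.1) _ hs).1
    rw [Finset.mul_sum, Finset.sum_eq_single v] at h
    · rw [mul_smul_comm, vertex_mul_vertex, if_pos rfl] at h
      by_contra hg
      exact v.2 ((Submodule.smul_mem_iff I hg).1 h)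
    · intro w _ hw
      rw [mul_smul_comm, vertex_mul_vertex, if_neg fun h => hw (Subtype.ext h).symm, smul_zero]
    · exact fun h => absurd hv h
  have := hli.finite
  exact Set.toFinite _

end QuiverAlgebra

/-! ### The coalgebra `K[V]⁰` -/

section QuiverFiniteDual

variable {K V : Type*} [Field K] [Quiver V]

theorem finiteDual_vertex_finite (f : finiteDual K (QuiverAlgebra K V)) :
    (Function.support fun v : V => (f : Module.Dual K (QuiverAlgebra K V)) (vertex K v)).Finite := by
  obtain ⟨f, I, hI, hfin, hf⟩ := f
  exact (finite_vertex_notMem hI hfin).subset fun v hv hv' => hv (hf hv')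

variable (K V) in
/-- The counit of `K[V]⁰`: `f` is sent to the (finite) sum of its values at the vertices. -/
def finiteDualCounit : finiteDual K (QuiverAlgebra K V) →ₗ[K] K where
  toFun f := ∑ᶠ v : V, (f : Module.Dual K (QuiverAlgebra K V)) (vertex K v)
  map_add' f g := finsum_add_distrib (finiteDual_vertex_finite f) (finiteDual_vertex_finite g)
  map_smul' c _ := (smul_finsum c _).symm

theorem finiteDualCounit_eq (f : finiteDual K (QuiverAlgebra K V)) :
    ∃ F₀ : Finset V, ∀ F, F₀ ⊆ F →
      finiteDualCounit K V f = finiteDualEval (∑ v ∈ F, vertex K v) f := by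
  refine ⟨(finiteDual_vertex_finite f).toFinset, fun F hF => ?_⟩
  refine Eq.trans ?_ (map_sum (f : Module.Dual K (QuiverAlgebra K V)) _ F).symm
  exact finsum_eq_sum_of_support_subset _ fun v hv => hF (by simpa using hv)

/-- The coalgebra structure of the finite dual of the quiver algebra. -/
instance : Coalgebra K (finiteDual K (QuiverAlgebra K V)) where
  comul := finiteDualComul
  counit := finiteDualCounit K V
  coassoc := coassoc_of_pairing finiteDualEval finiteDualEval_separating finiteDualComul
    pairFun_finiteDualComul
  rTensor_counit_comp_comul := (counit_of_pairing finiteDualEval finiteDualEval_separating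
    finiteDualComul pairFun_finiteDualComul (fun F : Finset V => ∑ v ∈ F, vertex K v)
    vertexSum_local_unit (finiteDualCounit K V) finiteDualCounit_eq).1
  lTensor_counit_comp_comul := (counit_of_pairing finiteDualEval finiteDualEval_separating
    finiteDualComul pairFun_finiteDualComul (fun F : Finset V => ∑ v ∈ F, vertex K v)
    vertexSum_local_unit (finiteDualCounit K V) finiteDualCounit_eq).2

end QuiverFiniteDual

/-! ### The path coalgebra -/

section PathCoalgebra

variable (K V : Type*) [Field K] [Quiver V]

/-- The underlying space of the path coalgebra: the vector space with basis all paths. -/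
def PathCoalgebra : Type _ := QPath V →₀ K

instance : AddCommGroup (PathCoalgebra K V) := inferInstanceAs (AddCommGroup (QPath V →₀ K))

instance : Module K (PathCoalgebra K V) := inferInstanceAs (Module K (QPath V →₀ K))

/-- The basis of the path coalgebra given by the paths. -/
def pathBasis : Module.Basis (QPath V) K (PathCoalgebra K V) := .ofRepr (.refl K (QPath V →₀ K))

/-- The comultiplication: a path `p` is sent to the sum of all `q ⊗ r` with `qr = p`. -/
def pathComul : PathCoalgebra K V →ₗ[K] PathCoalgebra K V ⊗[K] PathCoalgebra K V :=
  (pathBasis K V).constr K fun p =>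
    ∑ qr ∈ p.finite_splits.toFinset, pathBasis K V qr.1 ⊗ₜ[K] pathBasis K V qr.2

/-- The counit: `1` on the vertices and `0` on the paths of positive length. -/
def pathCounit : PathCoalgebra K V →ₗ[K] K :=
  (pathBasis K V).constr K fun p => if p.path.length = 0 then 1 else 0

/-- The linear map `θ` into the dual of the quiver algebra, `θ(p)(q) = δ_{p,q}` for paths. -/
def theta : PathCoalgebra K V →ₗ[K] Module.Dual K (QuiverAlgebra K V) :=
  (pathBasis K V).constr K fun p => (Finsupp.lapply p : (QPath V →₀ K) →ₗ[K] K)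

variable {K V}

@[elab_as_elim]
theorem PathCoalgebra.induction {P : PathCoalgebra K V → Prop} (zero : P 0)
    (add : ∀ x y, P x → P y → P (x + y)) (smul : ∀ (k : K) p, P (k • pathBasis K V p))
    (c : PathCoalgebra K V) : P c := by
  refine Finsupp.induction_linear (motive := P) c zero add fun p k => ?_
  have e : k • pathBasis K V p = (Finsupp.single p k : QPath V →₀ K) := Finsupp.smul_single_one p k
  exact e ▸ smul k p

theorem pathComul_basis (p : QPath V) : pathComul K V (pathBasis K V p) =
    ∑ qr ∈ p.finite_splits.toFinset, pathBasis K V qr.1 ⊗ₜ[K] pathBasis K V qr.2 :=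
  (pathBasis K V).constr_basis K _ p

theorem pathCounit_basis (p : QPath V) : pathCounit K V (pathBasis K V p) =
    if p.path.length = 0 then 1 else 0 :=
  (pathBasis K V).constr_basis K _ p

theorem theta_basis (p q : QPath V) [Decidable (p = q)] :
    theta K V (pathBasis K V p) (ofPath K q) = if p = q then 1 else 0 := by
  have h : theta K V (pathBasis K V p) = (Finsupp.lapply p : (QPath V →₀ K) →ₗ[K] K) :=
    (pathBasis K V).constr_basis K _ p
  rw [h]
  change (Finsupp.single q (1 : K)) p = _
  classical
  rw [Finsupp.single_apply]
  simp only [eq_comm (a := p) (b := q)]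

theorem theta_ofPath (c : PathCoalgebra K V) (q : QPath V) :
    theta K V c (ofPath K q) = (pathBasis K V).repr c q := by
  classical
  have : (theta K V).flip (ofPath K q) = (pathBasis K V).coord q :=
    (pathBasis K V).ext fun p => by
      rw [LinearMap.flip_apply, theta_basis, Module.Basis.coord_apply, Module.Basis.repr_self,
        Finsupp.single_apply]
  exact LinearMap.congr_fun this c

theorem theta_separating (c c' : PathCoalgebra K V)
    (h : ∀ a, (theta K V).flip a c = (theta K V).flip a c') : c = c' := by
  refine (pathBasis K V).repr.injective (Finsupp.ext fun q => ?_)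
  rw [← theta_ofPath, ← theta_ofPath]
  exact h (ofPath K q)

theorem pairFun_pathComul (x y : QuiverAlgebra K V) (c : PathCoalgebra K V) :
    pairFun ((theta K V).flip x) ((theta K V).flip y) (pathComul K V c) =
      (theta K V).flip (x * y) c := by
  classical
  have key : ∀ p q r : QPath V,
      pairFun ((theta K V).flip (ofPath K q)) ((theta K V).flip (ofPath K r))
        (pathComul K V (pathBasis K V p)) =
        (theta K V).flip (ofPath K q * ofPath K r) (pathBasis K V p) := by
    intro p q r
    rw [pathComul_basis, map_sum, ofPath_mul_ofPath]
    simp only [TensorProduct.dualDistrib_apply, LinearMap.flip_apply, theta_basis]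
    have h1 : ∀ x : QPath V × QPath V, ((if x.1 = q then (1 : K) else 0) *
        if x.2 = r then 1 else 0) = if (q, r) = x then 1 else 0 := by
      rintro ⟨a, b⟩
      simp only [Prod.mk.injEq, eq_comm (a := q), eq_comm (a := r)]
      by_cases ha : a = q <;> by_cases hb : b = r <;> simp [ha, hb]
    simp only [h1, Finset.sum_ite_eq, Set.Finite.mem_toFinset, Set.mem_ofPred_eq]
    cases h : q.concat r with
    | none => simp
    | some z => simp [theta_basis, eq_comm]
  induction x using QuiverAlgebra.induction with
  | zero => simp [pairFun]
  | add x x' hx hx' =>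
    simp only [pairFun] at hx hx' ⊢
    simp only [add_mul, map_add, TensorProduct.add_tmul, LinearMap.add_apply, hx, hx']
  | smul d q =>
    induction y using QuiverAlgebra.induction with
    | zero => simp [pairFun]
    | add y y' hy hy' =>
      simp only [pairFun] at hy hy' ⊢
      simp only [mul_add, map_add, TensorProduct.tmul_add, LinearMap.add_apply, hy, hy']
    | smul e r =>
      have h2 : pairFun ((theta K V).flip (ofPath K q)) ((theta K V).flip (ofPath K r)) ∘ₗ
          pathComul K V = (theta K V).flip (ofPath K q * ofPath K r) :=
        (pathBasis K V).ext fun p => key p q r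
      have h3 := LinearMap.congr_fun h2 c
      rw [LinearMap.comp_apply] at h3
      simp only [pairFun] at h3 ⊢
      simp only [map_smul, ← TensorProduct.smul_tmul', TensorProduct.tmul_smul,
        LinearMap.smul_apply, smul_mul_assoc, mul_smul_comm, h3]

theorem pathCounit_eq (c : PathCoalgebra K V) : ∃ F₀ : Finset V, ∀ F, F₀ ⊆ F →
    pathCounit K V c = (theta K V).flip (∑ v ∈ F, vertex K v) c := by
  classical
  induction c using PathCoalgebra.induction with
  | zero => exact ⟨∅, by simp⟩
  | add x y hx hy =>
    obtain ⟨F1, h1⟩ := hx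
    obtain ⟨F2, h2⟩ := hy
    refine ⟨F1 ∪ F2, fun F hF => ?_⟩
    rw [map_add, map_add, h1 F (Finset.union_subset_left hF),
      h2 F (Finset.union_subset_right hF)]
  | smul k p =>
    refine ⟨{p.src}, fun F hF => ?_⟩
    have hs : p.src ∈ F := hF (by simp)
    rw [map_smul, map_smul, pathCounit_basis, LinearMap.flip_apply, map_sum]
    congr 1
    simp only [vertex, theta_basis]
    obtain ⟨a, b, p⟩ := p
    cases p with
    | nil =>
      rw [Finset.sum_eq_single a]
      · simp
      · intro v _ hv
        rw [if_neg]
        intro h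
        exact hv (congrArg QPath.src h).symm
      · exact fun h => absurd hs h
    | cons p e =>
      rw [Finset.sum_eq_zero]
      · simp
      · intro v _
        rw [if_neg]
        intro h
        have := congrArg (fun z : QPath V => z.path.length) h
        simp at this

instance : Coalgebra K (PathCoalgebra K V) where
  comul := pathComul K V
  counit := pathCounit K V
  coassoc := coassoc_of_pairing (fun a => (theta K V).flip a) theta_separating (pathComul K V)
    pairFun_pathComul
  rTensor_counit_comp_comul := (counit_of_pairing (fun a => (theta K V).flip a) theta_separating
    (pathComul K V) pairFun_pathComul (fun F : Finset V => ∑ v ∈ F, vertex K v)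
    vertexSum_local_unit (pathCounit K V) pathCounit_eq).1
  lTensor_counit_comp_comul := (counit_of_pairing (fun a => (theta K V).flip a) theta_separating
    (pathComul K V) pairFun_pathComul (fun F : Finset V => ∑ v ∈ F, vertex K v)
    vertexSum_local_unit (pathCounit K V) pathCounit_eq).2

end PathCoalgebra

/-! ### The coalgebra map `θ : KV → K[V]⁰` -/

section Theta

variable {K V : Type*} [Field K] [Quiver V]

/-- The span of a set of paths that absorbs concatenation is an ideal. -/
theorem isIdeal_span {S : Set (QPath V)}
    (hl : ∀ p q r : QPath V, p.concat q = some r → q ∈ S → r ∈ S)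
    (hr : ∀ p q r : QPath V, p.concat q = some r → p ∈ S → r ∈ S) :
    IsIdeal (Submodule.span K (ofPath K '' S)) := by
  intro a x hx
  induction a using QuiverAlgebra.induction with
  | zero => simp
  | add a b ha hb =>
    rw [add_mul, mul_add]
    exact ⟨add_mem ha.1 hb.1, add_mem ha.2 hb.2⟩
  | smul c p =>
    rw [smul_mul_assoc, mul_smul_comm]
    suffices h : ofPath K p * x ∈ Submodule.span K (ofPath K '' S) ∧
        x * ofPath K p ∈ Submodule.span K (ofPath K '' S) from
      ⟨Submodule.smul_mem _ _ h.1, Submodule.smul_mem _ _ h.2⟩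
    induction hx using Submodule.span_induction with
    | mem x hx =>
      obtain ⟨q, hq, rfl⟩ := hx
      rw [ofPath_mul_ofPath, ofPath_mul_ofPath]
      constructor
      · cases h : p.concat q with
        | none => simp
        | some z => exact Submodule.subset_span ⟨z, hl p q z h hq, rfl⟩
      · cases h : q.concat p with
        | none => simp
        | some z => exact Submodule.subset_span ⟨z, hr q p z h hq, rfl⟩
    | zero => simp
    | add x y _ _ hx hy =>
      rw [add_mul, mul_add]
      exact ⟨add_mem hx.1 hy.1, add_mem hx.2 hy.2⟩
    | smul d x _ hx =>
      rw [smul_mul_assoc, mul_smul_comm]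
      exact ⟨Submodule.smul_mem _ _ hx.1, Submodule.smul_mem _ _ hx.2⟩

/-- The set of subpaths of a path. -/
def subpaths (p : QPath V) : Set (QPath V) :=
  {q | ∃ r s t : QPath V, r.concat q = some t ∧ t.concat s = some p}

theorem finite_subpaths (p : QPath V) : (subpaths p).Finite := by
  have h := p.finite_splits.biUnion fun ts _ =>
    (ts.1.finite_splits.image fun rq : QPath V × QPath V => rq.2)
  refine h.subset ?_
  rintro q ⟨r, s, t, h1, h2⟩
  simp only [Set.mem_iUnion]
  exact ⟨(t, s), h2, (r, q), h1, rfl⟩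

theorem self_mem_subpaths (p : QPath V) : p ∈ subpaths p := by
  obtain ⟨a, b, p⟩ := p
  refine ⟨⟨a, a, .nil⟩, ⟨b, b, .nil⟩, ⟨a, b, p⟩, ?_, ?_⟩ <;> simp [QPath.concat_mk]

theorem mem_subpaths_right {p q r z : QPath V} (h : p.concat q = some r) (hr : r ∈ subpaths z) :
    q ∈ subpaths z := by
  obtain ⟨x, y, t, h1, h2⟩ := hr
  have ha := QPath.concat_assoc x p q
  rw [h, Option.bind_some, h1] at ha
  cases hxp : x.concat p with
  | none => simp [hxp] at ha
  | some w =>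
    rw [hxp, Option.bind_some] at ha
    exact ⟨w, y, t, ha, h2⟩

theorem mem_subpaths_left {p q r z : QPath V} (h : p.concat q = some r) (hr : r ∈ subpaths z) :
    p ∈ subpaths z := by
  obtain ⟨x, y, t, h1, h2⟩ := hr
  have ha := QPath.concat_assoc x p q
  rw [h, Option.bind_some, h1] at ha
  cases hxp : x.concat p with
  | none => simp [hxp] at ha
  | some w =>
    rw [hxp, Option.bind_some] at ha
    have hb := QPath.concat_assoc w q y
    rw [ha, Option.bind_some, h2] at hb
    cases hqy : q.concat y with
    | none => simp [hqy] at hb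
    | some u =>
      rw [hqy, Option.bind_some] at hb
      exact ⟨x, u, w, hxp, hb.symm⟩

theorem cofg_span_compl {S : Set (QPath V)} (hS : S.Finite) :
    (Submodule.span K (ofPath K '' Sᶜ)).CoFG := by
  have hfg : (Submodule.span K (ofPath K '' S)).FG := Submodule.fg_span (hS.image _)
  refine hfg.cofg_of_codisjoint (codisjoint_iff.2 (eq_top_iff.2 fun x _ => ?_))
  rw [← Submodule.span_union, ← Set.image_union]
  induction x using QuiverAlgebra.induction with
  | zero => exact zero_mem _
  | add x y hx hy => exact add_mem (hx trivial) (hy trivial)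
  | smul c p =>
    exact Submodule.smul_mem _ _ (Submodule.subset_span ⟨p, by simp, rfl⟩)

theorem theta_mem (c : PathCoalgebra K V) : theta K V c ∈ finiteDual K (QuiverAlgebra K V) := by
  classical
  induction c using PathCoalgebra.induction with
  | zero => simp
  | add x y hx hy =>
    rw [map_add]
    exact add_mem hx hy
  | smul k p =>
    rw [map_smul]
    refine Submodule.smul_mem _ _ ⟨Submodule.span K (ofPath K '' (subpaths p)ᶜ),
      isIdeal_span (fun x y z h hy hz => hy (mem_subpaths_right h hz))
        (fun x y z h hx hz => hx (mem_subpaths_left h hz)),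
      cofg_span_compl (finite_subpaths p), ?_⟩
    rw [Submodule.span_le]
    rintro _ ⟨q, hq, rfl⟩
    have hne : p ≠ q := fun h => hq (h ▸ self_mem_subpaths p)
    change theta K V (pathBasis K V p) (ofPath K q) = 0
    rw [theta_basis, if_neg hne]

variable (K V) in
/-- `θ` as a morphism of coalgebras from the path coalgebra to the finite dual of the quiver
algebra. -/
def thetaHom : PathCoalgebra K V →ₗc[K] finiteDual K (QuiverAlgebra K V) where
  toLinearMap := (theta K V).codRestrict _ theta_mem
  counit_comp := by
    ext c
    obtain ⟨F1, h1⟩ := pathCounit_eq c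
    obtain ⟨F2, h2⟩ := finiteDualCounit_eq ((theta K V).codRestrict _ theta_mem c)
    classical
    exact (h2 (F1 ∪ F2) Finset.subset_union_right).trans
      (h1 (F1 ∪ F2) Finset.subset_union_left).symm
  map_comp_comul := by
    ext c
    refine eq_of_pairFun finiteDualEval finiteDualEval finiteDualEval_separating
      finiteDualEval_separating fun x y => ?_
    refine Eq.trans ?_ (pairFun_finiteDualComul x y _).symm
    exact (pairFun_map _ _ _ _ _).trans (pairFun_pathComul x y c)

end Theta

/-! ### Left comodules and corestriction -/

section Comodules

open CategoryTheory

universe m k c d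

/-- Left comodules over the `K`-coalgebra `C`. -/
structure LeftComodule (K : Type k) (C : Type c) [Field K] [AddCommMonoid C] [Module K C]
    [Coalgebra K C] where
  carrier : Type m
  [addCommGroup : AddCommGroup carrier]
  [module : Module K carrier]
  /-- The coaction. -/
  coact : carrier →ₗ[K] C ⊗[K] carrier
  coassoc : TensorProduct.assoc K C C carrier ∘ₗ Coalgebra.comul.rTensor carrier ∘ₗ coact =
    coact.lTensor C ∘ₗ coact
  counit_coact : Coalgebra.counit.rTensor carrier ∘ₗ coact = TensorProduct.mk K K carrier 1

attribute [instance] LeftComodule.addCommGroup LeftComodule.module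

variable {K : Type k} {C : Type c} {D : Type d} [Field K] [AddCommMonoid C] [Module K C]
  [Coalgebra K C] [AddCommMonoid D] [Module K D] [Coalgebra K D]

/-- Morphisms of left comodules: linear maps compatible with the coactions. -/
@[ext] structure LeftComodule.Hom (M N : LeftComodule.{m} K C) where
  toLinearMap : M.carrier →ₗ[K] N.carrier
  comm : N.coact ∘ₗ toLinearMap = toLinearMap.lTensor C ∘ₗ M.coact

instance : Category (LeftComodule.{m} K C) where
  Hom M N := LeftComodule.Hom M N
  id M := ⟨LinearMap.id, by simp⟩
  comp f g := ⟨g.toLinearMap ∘ₗ f.toLinearMap, by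
    rw [← LinearMap.comp_assoc, g.comm, LinearMap.comp_assoc, f.comm, LinearMap.lTensor_comp,
      LinearMap.comp_assoc]⟩

theorem corestrict_coassoc (f : C →ₗc[K] D) (M : LeftComodule.{m} K C) :
    TensorProduct.assoc K D D M.carrier ∘ₗ Coalgebra.comul.rTensor M.carrier ∘ₗ
        (f.toLinearMap.rTensor M.carrier ∘ₗ M.coact) =
      (f.toLinearMap.rTensor M.carrier ∘ₗ M.coact).lTensor D ∘ₗ
        (f.toLinearMap.rTensor M.carrier ∘ₗ M.coact) := by
  have h1 : (TensorProduct.assoc K D D M.carrier).toLinearMap ∘ₗ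
      (TensorProduct.map f.toLinearMap f.toLinearMap).rTensor M.carrier =
      TensorProduct.map f.toLinearMap (f.toLinearMap.rTensor M.carrier) ∘ₗ
        (TensorProduct.assoc K C C M.carrier).toLinearMap :=
    TensorProduct.ext_threefold fun x y z => by simp
  have h2 : TensorProduct.map f.toLinearMap (f.toLinearMap.rTensor M.carrier) ∘ₗ
      M.coact.lTensor C = (f.toLinearMap.rTensor M.carrier ∘ₗ M.coact).lTensor D ∘ₗ
        f.toLinearMap.rTensor M.carrier :=
    TensorProduct.ext' fun x y => by simp
  calc _ = (TensorProduct.assoc K D D M.carrier).toLinearMap ∘ₗ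
        ((Coalgebra.comul ∘ₗ f.toLinearMap).rTensor M.carrier) ∘ₗ M.coact := by
        rw [LinearMap.rTensor_comp, LinearMap.comp_assoc]
    _ = ((TensorProduct.assoc K D D M.carrier).toLinearMap ∘ₗ
        (TensorProduct.map f.toLinearMap f.toLinearMap).rTensor M.carrier) ∘ₗ
          Coalgebra.comul.rTensor M.carrier ∘ₗ M.coact := by
        rw [← f.map_comp_comul, LinearMap.rTensor_comp, LinearMap.comp_assoc, LinearMap.comp_assoc]
    _ = TensorProduct.map f.toLinearMap (f.toLinearMap.rTensor M.carrier) ∘ₗ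
          (M.coact.lTensor C ∘ₗ M.coact) := by
        rw [h1, LinearMap.comp_assoc, M.coassoc]
    _ = _ := by
        rw [← LinearMap.comp_assoc, h2, LinearMap.comp_assoc]

/-- Corestriction along a morphism of coalgebras `f : C → D`: a left `C`-comodule `M` becomes a
left `D`-comodule with the coaction `M → C ⊗ M → D ⊗ M`. -/
def corestrict (f : C →ₗc[K] D) : LeftComodule.{m} K C ⥤ LeftComodule.{m} K D where
  obj M :=
    { carrier := M.carrier
      coact := f.toLinearMap.rTensor M.carrier ∘ₗ M.coact
      coassoc := corestrict_coassoc f M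
      counit_coact := by
        rw [← LinearMap.comp_assoc, ← LinearMap.rTensor_comp, f.counit_comp, M.counit_coact] }
  map {M N} g := ⟨g.toLinearMap, by
    change (f.toLinearMap.rTensor N.carrier ∘ₗ N.coact) ∘ₗ g.toLinearMap =
      g.toLinearMap.lTensor D ∘ₗ (f.toLinearMap.rTensor M.carrier ∘ₗ M.coact)
    rw [LinearMap.comp_assoc, g.comm, ← LinearMap.comp_assoc, ← LinearMap.comp_assoc,
      LinearMap.rTensor_comp_lTensor, LinearMap.lTensor_comp_rTensor]⟩
  map_id _ := rfl
  map_comp _ _ := rfl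

end Comodules

/-! ### Representations of a quiver -/

section Representations

universe m k

variable {K : Type k} [Field K] {V : Type*} [Quiver V]

/-- For a representation `R` of the quiver `V`, that is, a family of vector spaces indexed by the
vertices and a family of linear maps indexed by the arrows, the linear map `f_p` given by a path. -/
def pathMap (R : V ⥤q ModuleCat.{m} K) {a : V} :
    ∀ {b : V}, Quiver.Path a b → (R.obj a →ₗ[K] R.obj b)
  | _, .nil => LinearMap.id
  | _, .cons p e => (R.map e).hom ∘ₗ pathMap R p

open Classical in
/-- A representation is locally finite if, for each vertex `u` and each `x ∈ V_u`, the elements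
`f_p(x)`, where `p` runs through the paths that start at `u`, span a finite dimensional subspace of
the direct sum of all the `V_v`. -/
def IsLocallyFinite (R : V ⥤q ModuleCat.{m} K) : Prop :=
  ∀ (u : V) (x : R.obj u), FiniteDimensional K
    (Submodule.span K (Set.range fun p : Σ v : V, Quiver.Path u v =>
      DirectSum.lof K V (fun v => R.obj v) p.1 (pathMap R p.2 x)))

/-- A representation is locally nilpotent if, for each vertex `u` and each `x ∈ V_u`, only finitely
many paths `p` satisfy `f_p(x) ≠ 0`. -/
def IsLocallyNilpotent (R : V ⥤q ModuleCat.{m} K) : Prop :=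
  ∀ (u : V) (x : R.obj u), {p : Σ v : V, Quiver.Path u v | pathMap R p.2 x ≠ 0}.Finite

end Representations

end QuiverCoalg

end

universe u w k m

noncomputable section

namespace QuiverCoalg

open scoped TensorProduct
open Submodule (CoFG)

/-! ### Paths inside a set of vertices -/

section PathsIn

variable {V : Type*} [Quiver V]

/-! Everything is compared with one finiteness condition: every finite set `W` of vertices has only
finitely many paths running inside it (`pathsIn W`). By `acyclic_and_finite_hom_iff` this is (i):
without oriented cycles a path inside `W` is shorter than the cardinality of `W`, while the powers
of a cycle, or infinitely many parallel arrows, give infinitely many paths inside a finite set.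

(i) ⇒ (iii): the vertices are orthogonal idempotents, so a cofinite ideal `I` contains all but a
finite set `W` of them, and with a vertex it contains every path through it. Hence `I` contains the
span of the paths that leave `W`, which is monomial, and cofinite by the condition. (iii) ⇒ (ii): a
functional killed by a cofinite monomial ideal is supported on finitely many paths, and these
functionals are exactly the image of `θ` (`mem_range_theta_iff`). (ii) ⇒ (iv): `θ` is always
injective, so it becomes an isomorphism of coalgebras.

(iv) ⇒ (i): for finite `W`, the functionals `pathCount`, indexed by pairs of vertices of `W`, form a
comultiplicative matrix in the finite dual, hence a finite dimensional comodule whose coefficients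
they are. Essential surjectivity puts these coefficients in the image of `θ`
(`LeftComodule.coeff_mem_range`), so each of them has finite support; together the supports are
`pathsIn W`.

(i) ⇔ (v): in a locally finite representation the paths that do not kill `x` stay inside a finite
set of vertices; conversely, `constantRep W` is locally finite, and no path inside `W` kills a
nonzero vector there. -/

theorem mem_vertices_comp {a b c : V} (p : Quiver.Path a b) (q : Quiver.Path b c) {x : V} :
    x ∈ (p.comp q).vertices ↔ x ∈ p.vertices ∨ x ∈ q.vertices := by
  induction q with
  | nil =>
    rw [Quiver.Path.comp_nil, Quiver.Path.vertices_nil, List.mem_singleton]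
    exact ⟨Or.inl, fun h => h.elim id fun h => h ▸ p.end_mem_vertices⟩
  | cons q e ih =>
    rw [Quiver.Path.comp_cons, Quiver.Path.mem_vertices_cons, Quiver.Path.mem_vertices_cons, ih,
      or_assoc]

/-- The paths all of whose vertices belong to `W`. -/
def pathsIn (W : Set V) : Set (QPath V) := {p | ∀ v ∈ p.path.vertices, v ∈ W}

theorem mk_mem_pathsIn {W : Set V} {a b : V} {p : Quiver.Path a b} :
    (⟨a, b, p⟩ : QPath V) ∈ pathsIn W ↔ ∀ v ∈ p.vertices, v ∈ W := Iff.rfl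

theorem src_mem_of_mem_pathsIn {W : Set V} {p : QPath V} (h : p ∈ pathsIn W) : p.src ∈ W :=
  h _ p.path.start_mem_vertices

theorem tgt_mem_of_mem_pathsIn {W : Set V} {p : QPath V} (h : p ∈ pathsIn W) : p.tgt ∈ W :=
  h _ p.path.end_mem_vertices

theorem nil_mem_pathsIn {W : Set V} {v : V} : (⟨v, v, .nil⟩ : QPath V) ∈ pathsIn W ↔ v ∈ W := by
  simp [mk_mem_pathsIn]

theorem comp_mem_pathsIn {W : Set V} {a b c : V} {p : Quiver.Path a b} {q : Quiver.Path b c} :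
    (⟨a, c, p.comp q⟩ : QPath V) ∈ pathsIn W ↔
      (⟨a, b, p⟩ : QPath V) ∈ pathsIn W ∧ (⟨b, c, q⟩ : QPath V) ∈ pathsIn W := by
  simp only [mk_mem_pathsIn, mem_vertices_comp, or_imp, forall_and]

theorem cons_mem_pathsIn {W : Set V} {a b c : V} {p : Quiver.Path a b} {e : b ⟶ c} :
    (⟨a, c, p.cons e⟩ : QPath V) ∈ pathsIn W ↔ (⟨a, b, p⟩ : QPath V) ∈ pathsIn W ∧ c ∈ W := by
  simp only [mk_mem_pathsIn, Quiver.Path.mem_vertices_cons, or_imp, forall_and, forall_eq]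

theorem concat_mem_pathsIn {W : Set V} {p q r : QPath V} (h : p.concat q = some r) :
    r ∈ pathsIn W ↔ p ∈ pathsIn W ∧ q ∈ pathsIn W := by
  obtain ⟨a, b, c, p', q', rfl, rfl, rfl⟩ := QPath.concat_eq_some h
  exact comp_mem_pathsIn

/-- A path of length `n + 1` inside `W` is one of length `n` inside `W` followed by an arrow that
ends in `W`, which leaves finitely many choices. -/
theorem finite_pathsIn_length (harr : ∀ a b : V, Finite (a ⟶ b)) {W : Set V} (hW : W.Finite)
    (n : ℕ) : {p ∈ pathsIn W | p.path.length = n}.Finite := by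
  induction n with
  | zero =>
    refine (hW.image fun v => (⟨v, v, .nil⟩ : QPath V)).subset ?_
    rintro ⟨a, b, p⟩ ⟨hp, h0⟩
    cases p with
    | nil => exact ⟨a, src_mem_of_mem_pathsIn hp, rfl⟩
    | cons p e => simp at h0
  | succ n ih =>
    refine (ih.biUnion fun p _ => hW.biUnion fun b _ =>
      Set.finite_range fun e : p.tgt ⟶ b => (⟨p.src, b, p.path.cons e⟩ : QPath V)).subset ?_
    rintro ⟨a, b, p⟩ ⟨hp, h0⟩
    cases p with
    | nil => simp at h0
    | cons p e =>
      rw [cons_mem_pathsIn] at hp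
      simp only [Set.mem_iUnion]
      exact ⟨⟨a, _, p⟩, ⟨hp.1, by simpa using h0⟩, b, hp.2, e, rfl⟩

/-- If the endpoint of the last arrow had been visited before, the part of the path since that visit
would close up to an oriented cycle. -/
theorem nodup_vertices (hcyc : ∀ (v : V) (p : Quiver.Path v v), p.length = 0) {a b : V}
    (p : Quiver.Path a b) : p.vertices.Nodup := by
  induction p with
  | nil => simp
  | @cons b c p e ih =>
    rw [Quiver.Path.vertices_cons, List.concat_eq_append, List.nodup_append_comm]
    refine List.nodup_cons.2 ⟨fun hc => ?_, by simpa using ih⟩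
    obtain ⟨p₁, p₂, -⟩ := p.exists_eq_comp_of_mem_vertices (by simpa using hc)
    simpa using hcyc c (p₂.cons e)

/-- A quiver has no oriented cycles and finitely many arrows between any two vertices if and only
if there are finitely many paths inside any finite set of vertices. -/
theorem acyclic_and_finite_hom_iff :
    ((∀ (v : V) (p : Quiver.Path v v), p.length = 0) ∧ ∀ a b : V, Finite (a ⟶ b)) ↔
      ∀ W : Set V, W.Finite → (pathsIn W).Finite := by
  classical
  constructor
  · rintro ⟨hcyc, harr⟩ W hW
    -- A path of length `n` visits `n + 1` vertices, distinct by `nodup_vertices`, so a path inside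
    -- `W` has length strictly below the cardinality of `W`.
    refine ((Set.finite_Iio hW.toFinset.card).biUnion
      fun n _ => finite_pathsIn_length harr hW n).subset fun p hp => ?_
    simp only [Set.mem_iUnion]
    refine ⟨p.path.length, ?_, hp, rfl⟩
    have h1 := List.toFinset_card_of_nodup (nodup_vertices hcyc p.path)
    have h2 : p.path.vertices.toFinset ⊆ hW.toFinset := fun v hv => by
      simpa using hp v (by simpa using hv)
    have h3 := Finset.card_le_card h2
    rw [h1, Quiver.Path.vertices_length] at h3
    exact h3
  · refine fun h => ⟨fun v p => ?_, fun a b => ?_⟩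
    · by_contra hp
      -- The powers of a cycle have pairwise different lengths, yet all stay inside the vertex set
      -- of the cycle.
      let pow : ℕ → Quiver.Path v v := fun n => n.rec .nil fun _ q => q.comp p
      have hlen : ∀ n, (pow n).length = n * p.length := fun n => by
        induction n with
        | zero => simp [pow]
        | succ n ih =>
          change ((pow n).comp p).length = _
          rw [Quiver.Path.length_comp, ih, Nat.succ_mul]
      refine Set.infinite_of_injective_forall_mem
        (f := fun n => (⟨v, v, pow n⟩ : QPath V)) (fun m n hmn => ?_) (fun n => ?_)
        (h {x | x ∈ p.vertices} (List.finite_toSet _))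
      · have := congrArg (fun z : QPath V => z.path.length) hmn
        simpa [hlen, hp] using this
      · induction n with
        | zero => exact nil_mem_pathsIn.2 p.start_mem_vertices
        | succ n ih => exact comp_mem_pathsIn.2 ⟨ih, fun _ hx => hx⟩
    · have := (h {a, b} (by simp)).to_subtype
      refine Finite.of_injective (β := pathsIn ({a, b} : Set V))
        (fun e => ⟨⟨a, b, e.toPath⟩, fun v hv => by
          simpa [Quiver.Path.vertices_toPath] using hv⟩) fun e e' he => ?_
      simpa [Quiver.Hom.toPath] using he

end PathsIn

/-! ### The finite dual and monomial ideals -/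

section MonomialIdeals

variable {K V : Type*} [Field K] [Quiver V]

/-- A path through a vertex `v` factors as `p₁ v p₂`, so it is a multiple of the idempotent `v`. -/
theorem ofPath_mem_of_vertex_mem {I : Submodule K (QuiverAlgebra K V)} (hI : IsIdeal I)
    {p : QPath V} (hp : p ∉ pathsIn {v | vertex K v ∉ I}) : ofPath K p ∈ I := by
  obtain ⟨a, b, p⟩ := p
  simp only [mk_mem_pathsIn, not_forall, Set.mem_ofPred_eq, not_not] at hp
  obtain ⟨v, hv, hvI⟩ := hp
  obtain ⟨p₁, p₂, rfl⟩ := p.exists_eq_comp_of_mem_vertices hv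
  have h := (hI (ofPath K ⟨v, b, p₂⟩) _ (hI (ofPath K ⟨a, v, p₁⟩) _ hvI).1).2
  simpa [vertex, ofPath_mul_ofPath, QPath.concat_mk] using h

/-- The ideal `J` is spanned by the paths that meet a vertex of `I`; a complement is spanned by the
paths inside the finite set of remaining vertices. -/
theorem exists_cofg_monomialIdeal_le (h : ∀ W : Set V, W.Finite → (pathsIn W).Finite)
    {I : Submodule K (QuiverAlgebra K V)} (hI : IsIdeal I) (hfin : I.CoFG) :
    ∃ J : Submodule K (QuiverAlgebra K V), IsMonomialIdeal J ∧ J.CoFG ∧ J ≤ I := by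
  refine ⟨Submodule.span K (ofPath K '' (pathsIn {v | vertex K v ∉ I})ᶜ),
    ⟨isIdeal_span (fun x y z hz hy hz' => hy ((concat_mem_pathsIn hz).1 hz').2)
      (fun x y z hz hx hz' => hx ((concat_mem_pathsIn hz).1 hz').1), _, rfl⟩,
    cofg_span_compl (h _ (finite_vertex_notMem hI hfin)), ?_⟩
  rw [Submodule.span_le]
  rintro _ ⟨p, hp, rfl⟩
  exact ofPath_mem_of_vertex_mem hI hp

/-- `QuiverAlgebra` and `PathCoalgebra` unfold to the same space of finitely supported functions, so
`pathBasis` serves for both. -/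
theorem linearIndependent_ofPath : LinearIndependent K (ofPath K : QPath V → _) :=
  (pathBasis K V).linearIndependent

theorem theta_range_le :
    LinearMap.range (theta K V) ≤ finiteDual K (QuiverAlgebra K V) := by
  rintro _ ⟨c, rfl⟩
  exact theta_mem c

/-- A functional on the quiver algebra is in the image of `θ` if and only if it vanishes on all but
finitely many paths. -/
theorem mem_range_theta_iff {f : Module.Dual K (QuiverAlgebra K V)} :
    f ∈ LinearMap.range (theta K V) ↔ {p | f (ofPath K p) ≠ 0}.Finite := by
  constructor
  · rintro ⟨c, rfl⟩
    refine ((pathBasis K V).repr c).hasFiniteSupport.subset fun p hp => ?_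
    rwa [Set.mem_ofPred_eq, theta_ofPath] at hp
  · intro hf
    refine ⟨(pathBasis K V).repr.symm (Finsupp.ofSupportFinite (fun p => f (ofPath K p)) hf),
      QuiverAlgebra.linearMap_ext fun p => ?_⟩
    rw [theta_ofPath, LinearEquiv.apply_symm_apply]
    rfl

theorem range_theta_eq_of_monomialIdeals
    (h : ∀ I : Submodule K (QuiverAlgebra K V), IsIdeal I → I.CoFG →
      ∃ J : Submodule K (QuiverAlgebra K V), IsMonomialIdeal J ∧ J.CoFG ∧ J ≤ I) :
    LinearMap.range (theta K V) = finiteDual K (QuiverAlgebra K V) := by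
  refine le_antisymm theta_range_le ?_
  rintro f ⟨I, hI, hfin, hf⟩
  obtain ⟨J, ⟨-, S, rfl⟩, hJ, hJI⟩ := h I hI hfin
  refine mem_range_theta_iff.2 (Set.Finite.subset (s := Sᶜ) ?_ fun p hp hpS =>
    hp (hf (hJI (Submodule.subset_span ⟨p, hpS, rfl⟩))))
  -- The paths outside `S` remain independent modulo the span of `S`; as that span is cofinite,
  -- there are finitely many of them.
  have hli : LinearIndependent K fun p : (Sᶜ : Set (QPath V)) =>
      (Submodule.span K (ofPath K '' S)).mkQ (ofPath K p.1) := by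
    have hli := (linearIndependent_ofPath (K := K) (V := V)).comp
      (Subtype.val : (Sᶜ : Set (QPath V)) → _) Subtype.val_injective
    refine hli.map ?_
    rw [Submodule.ker_mkQ, Set.range_comp, Subtype.range_coe]
    exact linearIndependent_ofPath.disjoint_span_image disjoint_compl_left
  have := hli.finite
  exact Set.toFinite _

end MonomialIdeals

/-! ### Comodules and their coefficients -/

section Coefficients

open CategoryTheory

universe c d

variable {K : Type k} {C : Type c} {D : Type d} [Field K] [AddCommMonoid C] [Module K C]
  [Coalgebra K C] [AddCommMonoid D] [Module K D] [Coalgebra K D]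

/-- Corestriction along an isomorphism of coalgebras is an equivalence. -/
theorem corestrict_isEquivalence (e : C ≃ₗc[K] D) :
    (corestrict.{m} (e : C →ₗc[K] D)).IsEquivalence := by
  -- Over a field every module is flat. Fullness uses this to cancel `e ⊗ id` from the identity
  -- saying that a linear map respects the corestricted coactions.
  have hinj (M : Type m) [AddCommGroup M] [Module K M] :
      Function.Injective ((e : C →ₗc[K] D).toLinearMap.rTensor M) :=
    Module.Flat.rTensor_preserves_injective_linearMap _ e.injective
  refine { faithful := ⟨fun {M N f g} h => ?_⟩, full := ⟨fun {M N} g => ?_⟩,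
           essSurj := ⟨fun M => ?_⟩ }
  · have h' := congrArg LeftComodule.Hom.toLinearMap h
    exact LeftComodule.Hom.ext h'
  · let g' : M.carrier →ₗ[K] N.carrier := g.toLinearMap
    have h : ((e : C →ₗc[K] D).toLinearMap.rTensor N.carrier ∘ₗ N.coact) ∘ₗ g' =
        g'.lTensor D ∘ₗ (e : C →ₗc[K] D).toLinearMap.rTensor M.carrier ∘ₗ M.coact := g.comm
    refine ⟨⟨g', LinearMap.ext fun x => hinj N.carrier ((LinearMap.congr_fun h x).trans ?_)⟩, rfl⟩
    simp only [← LinearMap.comp_apply, ← LinearMap.comp_assoc]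
    rw [LinearMap.lTensor_comp_rTensor, LinearMap.rTensor_comp_lTensor]
  · have h : (e : C →ₗc[K] D).toLinearMap.rTensor M.carrier ∘ₗ
        (e.symm : D →ₗc[K] C).toLinearMap.rTensor M.carrier ∘ₗ M.coact = M.coact := by
      have h1 : (e : C →ₗc[K] D).toLinearMap ∘ₗ (e.symm : D →ₗc[K] C).toLinearMap =
          LinearMap.id := LinearMap.ext fun x => e.apply_symm_apply x
      rw [← LinearMap.comp_assoc, ← LinearMap.rTensor_comp, h1, LinearMap.rTensor_id,
        LinearMap.id_comp]
    have hl : M.coact = (LinearMap.id : M.carrier →ₗ[K] M.carrier).lTensor D ∘ₗ M.coact := by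
      rw [LinearMap.lTensor_id, LinearMap.id_comp]
    -- The preimage is `M` corestricted along the inverse; the carrier is unchanged and the identity
    -- map is the isomorphism.
    refine ⟨(corestrict (e.symm : D →ₗc[K] C)).obj M,
      ⟨⟨⟨LinearMap.id, hl.trans ?_⟩, ⟨LinearMap.id, h.trans hl⟩, rfl, rfl⟩⟩⟩
    exact congrArg ((LinearMap.id : M.carrier →ₗ[K] M.carrier).lTensor D ∘ₗ ·) h.symm

/-- The coefficient `(id ⊗ φ) ρ(x)` of a left comodule. -/
def LeftComodule.coeff (M : LeftComodule.{m} K C) (φ : Module.Dual K M.carrier) :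
    M.carrier →ₗ[K] C :=
  TensorProduct.rid K C ∘ₗ φ.lTensor C ∘ₗ M.coact

theorem LeftComodule.coeff_corestrict (f : C →ₗc[K] D) (M : LeftComodule.{m} K C)
    (φ : Module.Dual K M.carrier) :
    ((corestrict f).obj M).coeff φ = f.toLinearMap ∘ₗ M.coeff φ := by
  have h : (TensorProduct.rid K D).toLinearMap ∘ₗ φ.lTensor D ∘ₗ
      f.toLinearMap.rTensor M.carrier = f.toLinearMap ∘ₗ
        (TensorProduct.rid K C).toLinearMap ∘ₗ φ.lTensor C :=
    TensorProduct.ext' fun x y => by simp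
  exact congrArg (· ∘ₗ M.coact) h

/-- Used for an isomorphism `g`: isomorphic comodules have the same coefficients, so these can be
computed on a preimage under corestriction. -/
theorem LeftComodule.coeff_hom {M N : LeftComodule.{m} K C} (g : M ⟶ N)
    (φ : Module.Dual K N.carrier) : N.coeff φ ∘ₗ g.toLinearMap = M.coeff (φ ∘ₗ g.toLinearMap) := by
  rw [coeff, coeff, LinearMap.comp_assoc, LinearMap.comp_assoc, g.comm, LinearMap.lTensor_comp]
  rfl

/-- If corestriction is essentially surjective, then the coefficients of all comodules belong to
the image of the morphism of coalgebras. -/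
theorem LeftComodule.coeff_mem_range (f : C →ₗc[K] D) [(corestrict.{m} f).EssSurj]
    (M : LeftComodule.{m} K D) (φ : Module.Dual K M.carrier) (x : M.carrier) :
    M.coeff φ x ∈ LinearMap.range f.toLinearMap := by
  let i := (corestrict.{m} f).objObjPreimageIso M
  have h1 := LinearMap.congr_fun (LeftComodule.coeff_hom i.hom φ) (i.inv.toLinearMap x)
  have h2 : i.hom.toLinearMap (i.inv.toLinearMap x) = x :=
    LinearMap.congr_fun (congrArg LeftComodule.Hom.toLinearMap i.inv_hom_id) x
  rw [LinearMap.comp_apply, h2] at h1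
  exact ⟨_, (h1.trans (LinearMap.congr_fun (LeftComodule.coeff_corestrict f _ _) _)).symm⟩

/-- The comodule with basis `b` given by a comultiplicative matrix of elements of `C`. -/
def LeftComodule.ofMatrix {ι : Type*} [Fintype ι] [DecidableEq ι] {M : Type m} [AddCommGroup M]
    [Module K M] (b : Module.Basis ι K M) (x : ι → ι → C)
    (hcomul : ∀ i j, Coalgebra.comul (R := K) (x i j) = ∑ l, x i l ⊗ₜ[K] x l j)
    (hcounit : ∀ i j, Coalgebra.counit (R := K) (x i j) = if i = j then 1 else 0) :
    LeftComodule.{m} K C where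
  carrier := M
  coact := b.constr K fun i => ∑ j, x i j ⊗ₜ[K] b j
  coassoc := b.ext fun i => by
    simp only [LinearMap.comp_apply, Module.Basis.constr_basis, map_sum, LinearMap.rTensor_tmul,
      LinearMap.lTensor_tmul, hcomul, TensorProduct.sum_tmul, TensorProduct.tmul_sum,
      LinearEquiv.coe_coe, TensorProduct.assoc_tmul]
    exact Finset.sum_comm
  counit_coact := b.ext fun i => by
    simp [hcounit, TensorProduct.ite_tmul]

/-- Every entry of a comultiplicative matrix is thus a coefficient of a comodule, to which
`LeftComodule.coeff_mem_range` applies. -/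
theorem LeftComodule.coeff_ofMatrix {ι : Type*} [Fintype ι] [DecidableEq ι] {M : Type m}
    [AddCommGroup M] [Module K M] (b : Module.Basis ι K M) (x : ι → ι → C)
    (hcomul : ∀ i j, Coalgebra.comul (R := K) (x i j) = ∑ l, x i l ⊗ₜ[K] x l j)
    (hcounit : ∀ i j, Coalgebra.counit (R := K) (x i j) = if i = j then 1 else 0) (i j : ι) :
    (LeftComodule.ofMatrix b x hcomul hcounit).coeff (b.coord j) (b i) = x i j := by
  change TensorProduct.rid K C ((b.coord j).lTensor C
    (b.constr K (fun i => ∑ j, x i j ⊗ₜ[K] b j) (b i))) = _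
  rw [Module.Basis.constr_basis]
  simp [Finsupp.single_apply]

end Coefficients

/-! ### The functionals that count the paths inside a finite set of vertices -/

section PathMatrix

variable (K : Type*) {V ι : Type*} [Field K] [Quiver V]

open Classical in
/-- The functional with value `1` on the paths from `g i` to `g j` inside the range of `g`, and
value `0` on all other paths. -/
def pathCount (g : ι → V) (i j : ι) : Module.Dual K (QuiverAlgebra K V) :=
  (pathBasis K V).constr K fun p =>
    if p ∈ pathsIn (Set.range g) ∧ p.src = g i ∧ p.tgt = g j then 1 else 0

open Classical in
theorem pathCount_ofPath (g : ι → V) (i j : ι) (p : QPath V) :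
    pathCount K g i j (ofPath K p) =
      if p ∈ pathsIn (Set.range g) ∧ p.src = g i ∧ p.tgt = g j then 1 else 0 :=
  (pathBasis K V).constr_basis K _ p

/-- A composite lies inside the range of `g` exactly when both factors do, and then the vertex where
they meet is `g l` for a single `l`, by injectivity. Non-composable paths contribute zero on both
sides. -/
theorem pathCount_mul [Fintype ι] {g : ι → V} (hg : Function.Injective g) (i j : ι)
    (x y : QuiverAlgebra K V) :
    pathCount K g i j (x * y) = ∑ l, pathCount K g i l x * pathCount K g l j y := by
  classical
  have key : ∀ p q : QPath V, pathCount K g i j (ofPath K p * ofPath K q) =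
      ∑ l, pathCount K g i l (ofPath K p) * pathCount K g l j (ofPath K q) := by
    intro p q
    rw [ofPath_mul_ofPath]
    cases h : p.concat q with
    | none =>
      have hne : p.tgt ≠ q.src := fun he => by simp [QPath.concat, he] at h
      refine (map_zero _).trans (Finset.sum_eq_zero fun l _ => ?_).symm
      rw [pathCount_ofPath, pathCount_ofPath, ite_zero_mul_ite_zero, if_neg]
      rintro ⟨⟨-, -, h1⟩, -, h2, -⟩
      exact hne (h1.trans h2.symm)
    | some r =>
      have hr := concat_mem_pathsIn (W := Set.range g) h
      obtain ⟨a, b, c, p, q, rfl, rfl, rfl⟩ := QPath.concat_eq_some h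
      simp only [Option.elim_some, pathCount_ofPath, ite_zero_mul_ite_zero, mul_one, hr]
      by_cases hb : b ∈ Set.range g
      · obtain ⟨l, rfl⟩ := hb
        rw [Finset.sum_eq_single l]
        · congr 1
          simp only [eq_iff_iff]
          tauto
        · intro l' _ hl'
          rw [if_neg]
          exact fun h => hl' (hg h.1.2.2.symm)
        · exact fun h => absurd (Finset.mem_univ _) h
      · rw [if_neg fun h => hb (tgt_mem_of_mem_pathsIn h.1.1), Finset.sum_eq_zero]
        exact fun l _ => if_neg fun h => hb (tgt_mem_of_mem_pathsIn h.1.1)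
  induction x using QuiverAlgebra.induction with
  | zero => simp
  | add x x' hx hx' => simp only [add_mul, map_add, hx, hx', Finset.sum_add_distrib]
  | smul c p =>
    induction y using QuiverAlgebra.induction with
    | zero => simp
    | add y y' hy hy' => simp only [mul_add, map_add, hy, hy', Finset.sum_add_distrib]
    | smul d q =>
      rw [smul_mul_smul_comm, map_smul, key]
      simp only [map_smul, smul_eq_mul, Finset.mul_sum]
      exact Finset.sum_congr rfl fun l _ => by ring

/-- By `pathCount_mul` the common kernel of all the `pathCount K g i j` is an ideal, and its
quotient embeds in the finite dimensional space `ι × ι → K`. -/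
theorem pathCount_mem [Fintype ι] {g : ι → V} (hg : Function.Injective g) (i j : ι) :
    pathCount K g i j ∈ finiteDual K (QuiverAlgebra K V) := by
  let φ : QuiverAlgebra K V →ₗ[K] ι × ι → K := LinearMap.pi fun s => pathCount K g s.1 s.2
  have hφ : ∀ x, x ∈ LinearMap.ker φ ↔ ∀ i j, pathCount K g i j x = 0 := fun x => by
    simp [φ, funext_iff]
  refine ⟨LinearMap.ker φ, fun a x hx => ?_, ?_, fun x hx => (hφ x).1 hx i j⟩
  · rw [hφ] at hx
    simp [hφ, pathCount_mul K hg, hx]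
  · exact (Module.Finite.equiv φ.quotKerEquivRange.symm :)

/-- The functional `pathCount` as an element of the finite dual. -/
def pathCountDual [Fintype ι] {g : ι → V} (hg : Function.Injective g) (i j : ι) :
    finiteDual K (QuiverAlgebra K V) :=
  ⟨pathCount K g i j, pathCount_mem K hg i j⟩

theorem comul_pathCountDual [Fintype ι] {g : ι → V} (hg : Function.Injective g) (i j : ι) :
    Coalgebra.comul (R := K) (pathCountDual K hg i j) =
      ∑ l, pathCountDual K hg i l ⊗ₜ[K] pathCountDual K hg l j := by
  refine eq_of_pairFun finiteDualEval finiteDualEval finiteDualEval_separating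
    finiteDualEval_separating fun x y => ?_
  refine (pairFun_finiteDualComul x y _).trans ?_
  rw [map_sum]
  exact pathCount_mul K hg i j x y

/-- A trivial path has equal endpoints, so the only vertex that can contribute to the sum is `g i`,
and only when `i = j`. -/
theorem counit_pathCountDual [Fintype ι] [DecidableEq ι] {g : ι → V} (hg : Function.Injective g)
    (i j : ι) :
    Coalgebra.counit (R := K) (pathCountDual K hg i j) = if i = j then 1 else 0 := by
  classical
  change ∑ᶠ v : V, pathCount K g i j (vertex K v) = _
  have h : ∀ v, pathCount K g i j (vertex K v) = if v = g i ∧ i = j then 1 else 0 := by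
    intro v
    rw [vertex, pathCount_ofPath, nil_mem_pathsIn]
    congr 1
    simp only [eq_iff_iff]
    constructor
    · rintro ⟨-, h1, h2⟩
      exact ⟨h1, hg (h1.symm.trans h2)⟩
    · rintro ⟨h1, rfl⟩
      exact ⟨⟨i, h1.symm⟩, h1, h1⟩
  simp only [h]
  rw [finsum_eq_single _ (g i) fun v hv => if_neg fun h => hv h.1]
  simp

/-- If all the functionals `pathCount` are in the image of `θ`, then there are finitely many
paths inside any finite set of vertices. -/
theorem finite_pathsIn_of_pathCount_mem
    (h : ∀ (n : ℕ) (g : Fin n → V), Function.Injective g → ∀ i j,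
      pathCount K g i j ∈ LinearMap.range (theta K V)) (W : Set V) (hW : W.Finite) :
    (pathsIn W).Finite := by
  classical
  obtain ⟨n, g, hg⟩ := hW.fin_param
  obtain ⟨hg, rfl⟩ := hg
  -- A path inside `W` lies in the support of the functional indexed by its own endpoints; these
  -- supports are finite in number and each is finite.
  refine (Set.finite_univ.biUnion fun i _ => Set.finite_univ.biUnion fun j _ =>
    mem_range_theta_iff.1 (h n g hg i j)).subset fun p hp => ?_
  obtain ⟨i, hi⟩ := src_mem_of_mem_pathsIn hp
  obtain ⟨j, hj⟩ := tgt_mem_of_mem_pathsIn hp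
  simp only [Set.mem_iUnion]
  refine ⟨i, trivial, j, trivial, ?_⟩
  rw [Set.mem_ofPred_eq, pathCount_ofPath, if_pos ⟨hp, hi.symm, hj.symm⟩]
  exact one_ne_zero

end PathMatrix

/-! ### Essential surjectivity of corestriction along `θ` -/

section ThetaEquivalence

open CategoryTheory

variable {K : Type k} [Field K] {V : Type u} [Quiver.{w} V]

theorem thetaHom_injective : Function.Injective (thetaHom K V) := fun c c' h =>
  theta_separating c c' fun a => LinearMap.congr_fun (congrArg Subtype.val h) a

theorem corestrict_thetaHom_isEquivalence
    (h : LinearMap.range (theta K V) = finiteDual K (QuiverAlgebra K V)) :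
    (corestrict.{m} (thetaHom K V)).IsEquivalence := by
  have hbij : Function.Bijective (thetaHom K V) := ⟨thetaHom_injective, fun f => by
    obtain ⟨c, hc⟩ := h.ge f.2
    exact ⟨c, Subtype.ext hc⟩⟩
  exact corestrict_isEquivalence (CoalgEquiv.ofBijective (f := thetaHom K V) hbij)

theorem pathCount_mem_range_theta [(corestrict.{max k m} (thetaHom K V)).EssSurj] {n : ℕ}
    {g : Fin n → V} (hg : Function.Injective g) (i j : Fin n) :
    pathCount K g i j ∈ LinearMap.range (theta K V) := by
  -- Lifting places the comodule `Kⁿ` in the universe `max k m` over which the functor is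
  -- considered.
  let b : Module.Basis (Fin n) K (ULift.{m} (Fin n → K)) :=
    (Pi.basisFun K (Fin n)).map ULift.moduleEquiv.symm
  obtain ⟨c, hc⟩ := LeftComodule.coeff_mem_range (thetaHom K V)
    (LeftComodule.ofMatrix b (pathCountDual K hg) (comul_pathCountDual K hg)
      (counit_pathCountDual K hg)) (b.coord j) (b i)
  rw [LeftComodule.coeff_ofMatrix] at hc
  exact ⟨c, congrArg Subtype.val hc⟩

end ThetaEquivalence

/-! ### Locally finite and locally nilpotent representations -/

section LocallyNilpotent

open CategoryTheory

variable {K : Type k} [Field K] {V : Type u} [Quiver.{w} V]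

theorem pathMap_comp (R : V ⥤q ModuleCat.{m} K) {a b c : V} (p : Quiver.Path a b)
    (q : Quiver.Path b c) : pathMap R (p.comp q) = pathMap R q ∘ₗ pathMap R p := by
  induction q with
  | nil => rfl
  | cons q e ih =>
    rw [Quiver.Path.comp_cons, pathMap, ih, pathMap, LinearMap.comp_assoc]

/-- If a path does not kill `x`, neither do its initial segments, so all its vertices are endpoints
of paths that do not kill `x`. Local finiteness makes the set of such endpoints finite. -/
theorem isLocallyNilpotent_of_isLocallyFinite (h : ∀ W : Set V, W.Finite → (pathsIn W).Finite)
    (R : V ⥤q ModuleCat.{m} K) (hR : IsLocallyFinite R) : IsLocallyNilpotent R := by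
  classical
  intro u x
  obtain ⟨S, hS⟩ := (Submodule.fg_iff_finiteDimensional _).2 (hR u x)
  -- The union of the supports of finitely many generators: every element of the span has zero
  -- component at the vertices outside `W`.
  let W : Finset V := S.biUnion fun y => DFinsupp.support y
  have hW : ∀ {v : V} (p : Quiver.Path u v), pathMap R p x ≠ 0 → v ∈ W := by
    intro v p hp
    by_contra hv
    have hle : Submodule.span K (S : Set (DirectSum V fun v => R.obj v)) ≤
        LinearMap.ker (DirectSum.component K V (fun v => R.obj v) v) := by
      rw [Submodule.span_le]
      intro y hy
      by_contra hy'
      exact hv (Finset.mem_biUnion.2 ⟨y, hy, DFinsupp.mem_support_iff.2 hy'⟩)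
    rw [hS] at hle
    have h0 := hle (Submodule.subset_span ⟨⟨v, p⟩, rfl⟩)
    rw [LinearMap.mem_ker] at h0
    refine hp (Eq.trans ?_ h0)
    convert (DirectSum.component.lof_self K (M := fun v => R.obj v) v (pathMap R p x)).symm
  refine ((h W W.finite_toSet).preimage
    (f := fun p : Σ v : V, Quiver.Path u v => (⟨u, p.1, p.2⟩ : QPath V)) ?_).subset ?_
  · rintro ⟨v, p⟩ - ⟨v', p'⟩ - hp
    simp only [QPath.mk.injEq, true_and] at hp
    obtain ⟨rfl, hp⟩ := hp
    rw [eq_of_heq hp]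
  · rintro ⟨v, p⟩ hp y hy
    obtain ⟨p₁, p₂, rfl⟩ := p.exists_eq_comp_of_mem_vertices hy
    refine hW p₁ fun h0 => hp ?_
    rw [pathMap_comp, LinearMap.comp_apply, h0, map_zero]

variable (K) in
open Classical in
/-- The representation with a copy of `K` at each vertex, in which the arrows between two vertices
of `W` act as the identity and all the other arrows act as zero. -/
def constantRep (W : Set V) : V ⥤q ModuleCat.{max k m} K where
  obj _ := ModuleCat.of K (ULift.{m} K)
  map {a b} _ := ModuleCat.ofHom (if a ∈ W ∧ b ∈ W then LinearMap.id else 0)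

open Classical in
theorem pathMap_constantRep_cons (W : Set V) {a b c : V} (p : Quiver.Path a b) (e : b ⟶ c)
    (x : ULift.{m} K) :
    (pathMap (constantRep.{u, w, k, m} K W) (p.cons e) x : ULift.{m} K) =
      if b ∈ W ∧ c ∈ W then (pathMap (constantRep.{u, w, k, m} K W) p x : ULift.{m} K) else 0 := by
  change (if b ∈ W ∧ c ∈ W then LinearMap.id else 0 : ULift.{m} K →ₗ[K] ULift.{m} K)
    (pathMap (constantRep.{u, w, k, m} K W) p x) = _
  split_ifs <;> rfl

theorem pathMap_constantRep_of_mem {W : Set V} {a b : V} (p : Quiver.Path a b)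
    (hp : (⟨a, b, p⟩ : QPath V) ∈ pathsIn W) (x : ULift.{m} K) :
    pathMap (constantRep.{u, w, k, m} K W) p x = x := by
  induction p with
  | nil => rfl
  | cons p e ih =>
    rw [cons_mem_pathsIn] at hp
    refine (pathMap_constantRep_cons W p e x).trans ?_
    rw [if_pos ⟨tgt_mem_of_mem_pathsIn hp.1, hp.2⟩]
    exact ih hp.1

/-- The source has to be added to `W` because the trivial path acts as the identity even at a vertex
outside `W`. Since `x` is only fixed or killed, its translates take finitely many values, which
gives local finiteness. -/
theorem pathMap_constantRep {W : Set V} {a b : V} (p : Quiver.Path a b) (x : ULift.{m} K) :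
    pathMap (constantRep.{u, w, k, m} K W) p x = 0 ∨
      b ∈ insert a W ∧ pathMap (constantRep.{u, w, k, m} K W) p x = x := by
  induction p with
  | nil => exact Or.inr ⟨Set.mem_insert _ _, rfl⟩
  | @cons b c p e ih =>
    have h := pathMap_constantRep_cons W p e x
    split_ifs at h with hbc
    · exact ih.imp h.trans fun h' => ⟨Set.mem_insert_of_mem _ hbc.2, h.trans h'.2⟩
    · exact Or.inl h

theorem isLocallyFinite_constantRep {W : Set V} (hW : W.Finite) :
    IsLocallyFinite (constantRep.{u, w, k, m} K W) := by
  classical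
  intro u x
  refine FiniteDimensional.span_of_finite K ((((hW.insert u).image fun v =>
    DirectSum.lof K V (fun v => (constantRep.{u, w, k, m} K W).obj v) v x).insert 0).subset ?_)
  rintro _ ⟨⟨v, p⟩, rfl⟩
  obtain h | ⟨hv, h⟩ := pathMap_constantRep (W := W) p x
  · left
    dsimp only
    rw [h, map_zero]
  · refine Or.inr ⟨v, hv, ?_⟩
    dsimp only
    rw [h]

/-- In `constantRep W` the vector `1` survives along every path inside `W`, so local nilpotency
leaves finitely many such paths from each of the finitely many sources. -/
theorem finite_pathsIn_of_isLocallyNilpotent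
    (h : ∀ R : V ⥤q ModuleCat.{max k m} K, IsLocallyFinite R → IsLocallyNilpotent R)
    (W : Set V) (hW : W.Finite) : (pathsIn W).Finite := by
  refine (hW.biUnion fun u _ =>
    (h (constantRep.{u, w, k, m} K W) (isLocallyFinite_constantRep hW) u (ULift.up 1)).image
      fun p : Σ v : V, Quiver.Path u v => (⟨u, p.1, p.2⟩ : QPath V)).subset ?_
  rintro ⟨a, b, p⟩ hp
  simp only [Set.mem_iUnion]
  refine ⟨a, src_mem_of_mem_pathsIn hp, ⟨b, p⟩, ?_, rfl⟩
  rw [Set.mem_ofPred_eq, pathMap_constantRep_of_mem p hp]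
  exact fun h0 => one_ne_zero (congrArg ULift.down h0)

end LocallyNilpotent

end QuiverCoalg

end

theorem theorem3p3 (K : Type k) [Field K] (V : Type u) [Quiver.{w} V] :
    List.TFAE [
      -- (i) no oriented cycles, and finitely many arrows between any two vertices
      (∀ (v : V) (p : Quiver.Path v v), p.length = 0) ∧ (∀ a b : V, Finite (a ⟶ b)),
      -- (ii) the image of the path coalgebra under `θ` is the whole finite dual
      LinearMap.range (QuiverCoalg.theta K V) =
        QuiverCoalg.finiteDual K (QuiverCoalg.QuiverAlgebra K V),
      -- (iii) every cofinite ideal contains a cofinite monomial ideal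
      ∀ I : Submodule K (QuiverCoalg.QuiverAlgebra K V), QuiverCoalg.IsIdeal I → I.CoFG →
        ∃ J : Submodule K (QuiverCoalg.QuiverAlgebra K V),
          QuiverCoalg.IsMonomialIdeal J ∧ J.CoFG ∧ J ≤ I,
      -- (iv) corestriction of left comodules along `θ` is an equivalence of categories
      (QuiverCoalg.corestrict.{max k m} (QuiverCoalg.thetaHom K V)).IsEquivalence,
      -- (v) locally finite representations are locally nilpotent
      ∀ R : V ⥤q ModuleCat.{max k m} K,
        QuiverCoalg.IsLocallyFinite R → QuiverCoalg.IsLocallyNilpotent R] := by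
  -- From here on, assertion 1 is the finiteness of the set of paths inside each finite set of
  -- vertices.
  rw [QuiverCoalg.acyclic_and_finite_hom_iff]
  tfae_have 1 → 3 := fun h I hI hfin => QuiverCoalg.exists_cofg_monomialIdeal_le h hI hfin
  tfae_have 3 → 2 := QuiverCoalg.range_theta_eq_of_monomialIdeals
  tfae_have 2 → 4 := QuiverCoalg.corestrict_thetaHom_isEquivalence
  tfae_have 4 → 1 := fun h => QuiverCoalg.finite_pathsIn_of_pathCount_mem K
    fun _ _ hg => QuiverCoalg.pathCount_mem_range_theta.{u, w, k, m} hg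
  tfae_have 1 → 5 := QuiverCoalg.isLocallyNilpotent_of_isLocallyFinite
  tfae_have 5 → 1 := QuiverCoalg.finite_pathsIn_of_isLocallyNilpotent.{u, w, k, m}
  tfae_finish
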